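/- Let $S=\mathbb{C}[x,y,z]$ with its standard grading ($S_k=0$ for $k<0$). For a homogeneous polynomial $g\in S$ let $$D_0(g)=\{(a,b,c)\in S^3 : a g_x+b g_y+c g_z=0\},$$ a graded $S$-module whose homogeneous component $D_0(g)_k$, $k\in\mathbb{Z}$, consists of the triples in $D_0(g)$ with entries in $S_k$. Its elements $\delta=(a,b,c)$ are also regarded as derivations $\delta=a\partial_x+b\partial_y+c\partial_z$ of $S$. Let $C':f'=0$ be a reduced curve of degree $n\ge 1$ in $\mathbb{P}^2$ over $\mathbb{C}$, let $L:\ell=0$ be a line not contained in $C'$, and let $C=C'\cup L$, with equation $f=\ell f'=0$ of degree $d=n+1$. Let $r$ be the number of points of the set $C'\cap L$ (counted without multiplicity). Let $u_0$ be the $S$-linear map $$u_0(\delta)=\ell\,\delta-\frac{\delta(\ell)}{d}\,E,\qquad E=(x,y,z),$$ that is, $u_0(a,b,c)=x\,(a,b,c)-\frac{a}{d}E$ if coordinates are chosen such that $L:x=0$. It maps $D_0(f')_{k-1}$ into $D_0(f)_k$ for all $k\in\mathbb{Z}$, and the following hold. 1. $u_0$ induces isomorphisms $D_0(f')_{k-1}\to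 D_0(f)_k$ of complex vector spaces for all $k\le r-2$. 2. For all sufficiently large $k$ one has $\dim_{\mathbb{C}} D_0(f')_{k-1}<\dim_{\mathbb{C}} D_0(f)_k$. Moreover, let $d_1\le\dots\le d_s$ be the exponents of $C$, i.e. the degrees of the members of a minimal system of homogeneous generators of the $S$-module $D_0(f)$ (such systems exist). Then $s\ge 1$ and the maximal exponent satisfies $d_s\ge r-1$. -/

import Mathlib

open MvPolynomial

noncomputable section

namespace JacSyz

/-- The graded polynomial ring `S = ℂ[x, y, z]`, with `x = X 0`, `y = X 1`, `z = X 2`. -/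
abbrev Poly : Type := MvPolynomial (Fin 3) ℂ

/-- The complex projective plane. -/
abbrev Plane : Type := Projectivization ℂ (Fin 3 → ℂ)

/-- The set of points of the projective plane at which the (homogeneous) polynomial `g` vanishes. -/
def zeroSet (g : Poly) : Set Plane := {p | eval p.rep g = 0}

/-- For homogeneous `g`, vanishing at a point does not depend on the homogeneous coordinates. -/
theorem mk_mem_zeroSet_iff {g : Poly} {n : ℕ} (hg : g.IsHomogeneous n) (v : Fin 3 → ℂ)
    (hv : v ≠ 0) : Projectivization.mk ℂ v hv ∈ zeroSet g ↔ eval v g = 0 := by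
  obtain ⟨a, ha⟩ := Projectivization.exists_smul_eq_mk_rep ℂ v hv
  have h : eval (Projectivization.mk ℂ v hv).rep g = (a : ℂ) ^ n * eval v g := by
    rw [← ha]
    have hs : ((a • v : Fin 3 → ℂ)) = fun i => (a : ℂ) * v i := rfl
    rw [hs, eval_eq, eval_eq, Finset.mul_sum]
    refine Finset.sum_congr rfl fun m hm => ?_
    have hd : ∑ i, m i = n := by
      have := hg (mem_support_iff.mp hm)
      simpa [Finsupp.weight_apply, Finsupp.sum_fintype] using this
    rw [Finset.prod_congr rfl fun i _ => mul_pow _ _ _, Finset.prod_mul_distrib,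
      Finset.prod_pow_eq_pow_sum, Finset.sum_subset (Finset.subset_univ _)
        (fun i _ hi => by simpa using hi), hd]
    ring
  simp [zeroSet, h]

/-- `f` is the equation of a reduced plane curve of degree `n ≥ 1`. -/
def IsReducedCurve (f : Poly) (n : ℕ) : Prop :=
  0 < n ∧ f.IsHomogeneous n ∧ Squarefree f

/-- `ℓ` is the equation of a line. -/
def IsLine (ℓ : Poly) : Prop := ℓ.IsHomogeneous 1 ∧ ℓ ≠ 0

/-- The value `D(g) = a g_x + b g_y + c g_z` at `g` of the derivation
`D = a ∂_x + b ∂_y + c ∂_z` given by the triple `δ = (a, b, c)`. -/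
def app (δ : Fin 3 → Poly) (g : Poly) : Poly := ∑ i, δ i * pderiv i g

theorem app_add (δ ε : Fin 3 → Poly) (g : Poly) : app (δ + ε) g = app δ g + app ε g := by
  simp [app, add_mul, Finset.sum_add_distrib]

theorem app_smul (a : Poly) (δ : Fin 3 → Poly) (g : Poly) : app (a • δ) g = a * app δ g := by
  simp [app, Finset.mul_sum, mul_assoc]

/-- The `S`-module `D_0(f)` of all derivations killing `f`, i.e. of all Jacobian syzygies
`(a, b, c)` with `a f_x + b f_y + c f_z = 0`. -/
def D0 (f : Poly) : Submodule Poly (Fin 3 → Poly) where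
  carrier := {δ | app δ f = 0}
  zero_mem' := by simp [app]
  add_mem' {a b} ha hb := by
    simp only [Set.mem_ofPred_eq] at *
    rw [app_add, ha, hb, add_zero]
  smul_mem' c a ha := by
    simp only [Set.mem_ofPred_eq] at *
    rw [app_smul, ha, mul_zero]

/-- The vector space `S_k` of homogeneous polynomials of degree `k ∈ ℤ`
(it is zero for `k < 0`). -/
def polyDeg (k : ℤ) : Submodule ℂ Poly :=
  weightedHomogeneousSubmodule ℂ (fun _ : Fin 3 => (1 : ℤ)) k

/-- The homogeneous component `D_0(f)_k`: the triples in `D_0(f)` with entries in `S_k`. -/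
def D0deg (f : Poly) (k : ℤ) : Submodule ℂ (Fin 3 → Poly) :=
  (D0 f).restrictScalars ℂ ⊓ Submodule.pi Set.univ (fun _ => polyDeg k)

theorem mem_polyDeg_iff {k : ℤ} {g : Poly} :
    g ∈ polyDeg k ↔ ∃ n : ℕ, g.IsHomogeneous n ∧ ((n : ℤ) = k ∨ g = 0) := by
  have hw : ∀ m : Fin 3 →₀ ℕ, Finsupp.weight (fun _ : Fin 3 => (1 : ℤ)) m =
      ((Finsupp.weight (1 : Fin 3 → ℕ) m : ℕ) : ℤ) := fun m => by
    simp [Finsupp.weight_apply, Finsupp.sum_fintype]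
  constructor
  · intro h
    by_cases hg : g = 0
    · exact ⟨0, by simp [hg, isHomogeneous_zero], Or.inr hg⟩
    · obtain ⟨m, hm⟩ := ne_zero_iff.mp hg
      refine ⟨Finsupp.weight (1 : Fin 3 → ℕ) m, fun m' hm' => ?_, Or.inl ?_⟩
      · have h1 := h hm
        have h2 := h hm'
        rw [hw] at h1 h2
        exact_mod_cast h2.trans h1.symm
      · rw [← hw]
        exact h hm
  · rintro ⟨n, hn, rfl | rfl⟩
    · intro m hm
      rw [hw]
      exact_mod_cast hn hm
    · exact Submodule.zero_mem _

/-- The components `D_0(f)_k` are finite dimensional, so their `finrank` is the dimension. -/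
theorem finite_D0deg (f : Poly) (k : ℤ) : Module.Finite ℂ (D0deg f k) := by
  have hp : Module.Finite ℂ (polyDeg k) := by
    refine Submodule.finiteDimensional_of_le (S₂ := restrictTotalDegree (Fin 3) ℂ k.toNat) ?_
    intro g hg
    obtain ⟨n, hn, rfl | rfl⟩ := mem_polyDeg_iff.mp hg
    · exact (mem_restrictTotalDegree _ _ _).mpr hn.totalDegree_le
    · exact Submodule.zero_mem _
  let φ : D0deg f k →ₗ[ℂ] (Fin 3 → polyDeg k) :=
    LinearMap.pi fun i => ((LinearMap.proj i).comp (D0deg f k).subtype).codRestrict (polyDeg k)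
      fun δ => δ.2.2 i (Set.mem_univ i)
  refine Module.Finite.of_injective φ fun a b hab => Subtype.ext (funext fun i => ?_)
  exact congrArg Subtype.val (congrFun hab i)

/-- The Euler derivation `E = (x, y, z)`. -/
def euler : Fin 3 → Poly := fun i => X i

/-- The morphism `u_0 : δ ↦ ℓ δ - (δ(ℓ) / d) E`. For `ℓ = x` and `δ = (a, b, c)` one has
`δ(ℓ) = a`, so this is `δ ↦ x δ - (a / d) E`. -/
def u0 (ℓ : Poly) (d : ℕ) : (Fin 3 → Poly) →ₗ[Poly] (Fin 3 → Poly) where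
  toFun δ := ℓ • δ - (C ((d : ℂ)⁻¹) * app δ ℓ) • euler
  map_add' a b := by
    rw [app_add, smul_add, mul_add, add_smul]
    abel
  map_smul' c a := by
    simp only [app_smul, RingHom.id_apply, smul_sub, smul_smul]
    congr 2
    · ring
    · ring

/-- `d_1 ≤ ⋯ ≤ d_s` are the exponents of `f = 0`: the degrees of the members `ρ_1, …, ρ_s` of a
minimal system of homogeneous generators of the `S`-module `D_0(f)`, ordered by degree. -/
def IsExponents (f : Poly) {s : ℕ} (d : Fin s → ℕ) : Prop :=
  Monotone d ∧ ∃ ρ : Fin s → (Fin 3 → Poly),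
    (∀ i, ρ i ∈ D0deg f (d i)) ∧
    Submodule.span Poly (Set.range ρ) = D0 f ∧
    ∀ i, ρ i ∉ Submodule.span Poly (ρ '' {i}ᶜ)

end JacSyz

end

namespace JacSyz

/-! As in the lemmas below, write `f` for the equation of the curve of degree n and `ℓ * f` for its
union with the line L. Surjectivity (`exists_u0_eq`): if η kills ℓf, then ℓ η(f) = -f η(ℓ), and
since ℓ does not divide f, η(ℓ) = ℓh and η(f) = -hf. The corrected field θ = η + (h/n)E kills f and
is tangent to L. If θ vanishes along L, then θ/ℓ is the preimage of η. The vanishing is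
`eval_eq_zero_of_tangent`. In a chart v + tw of L with w off the curve, θ becomes Av + Bw, and
Euler's relation turns θ(f) = 0 into (B - tA)φ' = -nAφ, with φ the restriction of f. Thus B - tA, of
degree at most k + 1, vanishes at the r or more distinct roots of φ; for k ≤ r - 2 it is zero, and
then so are A and B. Failure of surjectivity: κ = ∇ℓ × ∇f kills ℓ and f. An element of the image of
`u0` killing f is divisible by ℓ (`dvd_u0`), but κ is not. Multiples of κ give the strict
inequality. Generators all of degree at most r - 2 would lie in the image, which would then contain
κ. -/

theorem mem_D0_iff {f : Poly} {δ : Fin 3 → Poly} : δ ∈ D0 f ↔ app δ f = 0 := Iff.rfl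

theorem mem_D0deg_iff {f : Poly} {k : ℤ} {δ : Fin 3 → Poly} :
    δ ∈ D0deg f k ↔ app δ f = 0 ∧ ∀ i, δ i ∈ polyDeg k := by
  simp [D0deg, Submodule.mem_pi, mem_D0_iff]

theorem app_mul (δ : Fin 3 → Poly) (g h : Poly) :
    app δ (g * h) = g * app δ h + h * app δ g := by
  simp only [app, pderiv_mul, Fin.sum_univ_three]
  ring

theorem app_sub (δ ε : Fin 3 → Poly) (g : Poly) : app (δ - ε) g = app δ g - app ε g := by
  simp [app, sub_mul, Finset.sum_sub_distrib]

theorem app_euler {g : Poly} {n : ℕ} (hg : g.IsHomogeneous n) :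
    app euler g = C (n : ℂ) * g := by
  have := hg.sum_X_mul_pderiv
  simpa [app, euler, nsmul_eq_mul] using this

theorem u0_apply (ℓ : Poly) (d : ℕ) (δ : Fin 3 → Poly) :
    u0 ℓ d δ = ℓ • δ - (C ((d : ℂ)⁻¹) * app δ ℓ) • euler := rfl

/-! ### Linear forms: restriction to a line and divisibility. -/

theorem IsLine.exists_coeff {ℓ : Poly} (hL : IsLine ℓ) :
    ∃ a : Fin 3 → ℂ, a ≠ 0 ∧ ℓ = ∑ i, C (a i) * X i := by
  have h : ∀ i, ∃ c : ℂ, pderiv i ℓ = C c := fun i => by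
    have h0 : (pderiv i ℓ).IsHomogeneous 0 := hL.1.pderiv
    rw [← totalDegree_zero_iff_isHomogeneous, totalDegree_eq_zero_iff_eq_C] at h0
    exact ⟨_, h0⟩
  choose a ha using h
  have hs : ℓ = ∑ i, C (a i) * X i := by
    have := hL.1.sum_X_mul_pderiv
    rw [one_smul] at this
    rw [← this]
    exact Finset.sum_congr rfl fun i _ => by rw [ha, mul_comm]
  refine ⟨a, fun h0 => hL.2 ?_, hs⟩
  rw [hs]
  simp [h0]

theorem app_sum_C_mul_X (a : Fin 3 → ℂ) (δ : Fin 3 → Poly) :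
    app δ (∑ i, C (a i) * X i) = ∑ i, δ i * C (a i) := by
  simp [app, pderiv_X, Fin.sum_univ_three, Pi.single_apply]

/-- Restriction to the line `ℓ = 0`, realized by the projection from a point off the line. -/
theorem IsLine.exists_restriction {ℓ : Poly} (hL : IsLine ℓ) :
    ∃ ρ : Poly →ₐ[ℂ] Poly, (∀ p, ρ p = 0 ↔ ℓ ∣ p) ∧
      ∀ p v, ∃ v', eval v' ℓ = 0 ∧ eval v (ρ p) = eval v' p := by
  obtain ⟨a, ha, rfl⟩ := hL.exists_coeff
  obtain ⟨j, hj⟩ := Function.ne_iff.mp ha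
  rw [Pi.zero_apply] at hj
  -- A point with ℓ(c) = 1; the substitution q ↦ q - ℓ(q)c projects from c onto the plane ℓ = 0.
  set c : Fin 3 → ℂ := Pi.single j (a j)⁻¹ with hc
  have hac : ∑ i, a i * c i = 1 := by simp [hc, Pi.single_apply, hj]
  set ℓ : Poly := ∑ i, C (a i) * X i with hℓ
  let ρ : Poly →ₐ[ℂ] Poly := aeval fun i => X i - C (c i) * ℓ
  have hρX : ∀ i, ρ (X i) = X i - C (c i) * ℓ := fun i => by simp [ρ]
  have hρℓ : ρ ℓ = 0 := by
    have h1 : ρ ℓ = ∑ i, C (a i) * (X i - C (c i) * ℓ) := by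
      conv_lhs => rw [hℓ]
      simp only [map_sum, map_mul, hρX]
      exact Finset.sum_congr rfl fun i _ => by rw [← algebraMap_eq, AlgHom.commutes]
    rw [h1]
    simp only [mul_sub, Finset.sum_sub_distrib, ← mul_assoc, ← C_mul, ← Finset.sum_mul,
      ← map_sum, hac, map_one, one_mul]
    rw [← hℓ, sub_self]
  have hmk : ∀ p, ℓ ∣ p - ρ p := fun p => by
    have : (Ideal.Quotient.mkₐ ℂ (Ideal.span {ℓ})).comp ρ =
        Ideal.Quotient.mkₐ ℂ (Ideal.span {ℓ}) := by
      ext i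
      simp only [AlgHom.comp_apply, hρX, Ideal.Quotient.mkₐ_eq_mk]
      rw [Ideal.Quotient.eq, Ideal.mem_span_singleton]
      exact ⟨-C (c i), by ring⟩
    have h2 := DFunLike.congr_fun this p
    simp only [AlgHom.comp_apply, Ideal.Quotient.mkₐ_eq_mk] at h2
    exact Ideal.mem_span_singleton.mp (Ideal.Quotient.eq.mp h2.symm)
  refine ⟨ρ, fun p => ⟨fun h => by simpa [h] using hmk p, ?_⟩, fun p v => ?_⟩
  · rintro ⟨q, rfl⟩
    rw [map_mul, hρℓ, zero_mul]
  · have key : ∀ q, eval v (ρ q) = eval (fun i => eval v (ρ (X i))) q := fun q => by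
      have : ((aeval v : Poly →ₐ[ℂ] ℂ).comp ρ) =
          (aeval (fun i => eval v (ρ (X i))) : Poly →ₐ[ℂ] ℂ) := by
        ext i
        simp [aeval_eq_eval]
      have h3 := DFunLike.congr_fun this q
      simpa [aeval_eq_eval] using h3
    exact ⟨_, by rw [← key, hρℓ, map_zero], key p⟩

theorem IsLine.dvd_of_eval {ℓ : Poly} (hL : IsLine ℓ) {p : Poly}
    (h : ∀ v, eval v ℓ = 0 → eval v p = 0) : ℓ ∣ p := by
  obtain ⟨ρ, h1, h2⟩ := hL.exists_restriction
  refine (h1 p).mp (MvPolynomial.funext fun v => ?_)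
  obtain ⟨v', hv', he⟩ := h2 p v
  rw [he, h v' hv', map_zero]

/-- The multiples of ℓ are the kernel of a ring map into a domain. -/
theorem IsLine.dvd_or_dvd {ℓ : Poly} (hL : IsLine ℓ) {p q : Poly} (h : ℓ ∣ p * q) :
    ℓ ∣ p ∨ ℓ ∣ q := by
  obtain ⟨ρ, h1, -⟩ := hL.exists_restriction
  rw [← h1, map_mul, mul_eq_zero, h1, h1] at h
  exact h

theorem eval_eq_zero_of_dvd {p q : Poly} {v : Fin 3 → ℂ} (h : p ∣ q) (hp : eval v p = 0) :
    eval v q = 0 := by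
  obtain ⟨c, rfl⟩ := h
  rw [map_mul, hp, zero_mul]

/-! ### Graded pieces and existence of exponents. -/

theorem homogeneousComponent_mul_of_left {g p : Poly} {m : ℕ} (hg : g.IsHomogeneous m) (k : ℕ) :
    homogeneousComponent (m + k) (g * p) = g * homogeneousComponent k p := by
  conv_lhs => rw [← sum_homogeneousComponent p, Finset.mul_sum, map_sum]
  have h : ∀ j, homogeneousComponent (m + k) (g * homogeneousComponent j p) =
      if k = j then g * homogeneousComponent j p else 0 := fun j => by
    rw [homogeneousComponent_of_mem (hg.mul (homogeneousComponent_isHomogeneous j p))]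
    simp
  rw [Finset.sum_congr rfl fun j _ => h j, Finset.sum_ite_eq, ite_eq_left_iff]
  intro hk
  rw [homogeneousComponent_eq_zero _ _ (by simpa using hk), mul_zero]

theorem polyDeg_natCast {k : ℕ} {g : Poly} : g ∈ polyDeg (k : ℤ) ↔ g.IsHomogeneous k := by
  rw [mem_polyDeg_iff]
  constructor
  · rintro ⟨m, hm, h | rfl⟩
    · rwa [← Int.natCast_inj.mp h]
    · exact isHomogeneous_zero _ _ _
  · exact fun h => ⟨k, h, Or.inl rfl⟩

theorem polyDeg_mul {i j k : ℤ} {p q : Poly} (hp : p ∈ polyDeg i) (hq : q ∈ polyDeg j)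
    (hk : i + j = k) : p * q ∈ polyDeg k :=
  hk ▸ IsWeightedHomogeneous.mul hp hq

theorem polyDeg_C (c : ℂ) : C c ∈ polyDeg 0 := isWeightedHomogeneous_C _ _

theorem polyDeg_X (i : Fin 3) : (X i : Poly) ∈ polyDeg 1 := isWeightedHomogeneous_X _ _ _

theorem IsLine.mem_polyDeg {ℓ : Poly} (hL : IsLine ℓ) : ℓ ∈ polyDeg 1 :=
  mem_polyDeg_iff.mpr ⟨1, hL.1, Or.inl rfl⟩

theorem IsLine.mem_polyDeg_of_mul {ℓ : Poly} (hL : IsLine ℓ) {p : Poly} {k : ℤ}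
    (h : ℓ * p ∈ polyDeg k) : p ∈ polyDeg (k - 1) := by
  by_cases hp : p = 0
  · rw [hp]
    exact Submodule.zero_mem _
  obtain ⟨m, hm, rfl | h0⟩ := mem_polyDeg_iff.mp h
  · rcases m with _ | m
    · have h1 := totalDegree_mul_of_isDomain hL.2 hp
      rw [hm.totalDegree (mul_ne_zero hL.2 hp), hL.1.totalDegree hL.2] at h1
      omega
    · have h1 := homogeneousComponent_mul_of_left (p := p) hL.1 m
      rw [add_comm 1 m, homogeneousComponent_eq_self hm] at h1
      rw [mul_left_cancel₀ hL.2 h1]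
      exact mem_polyDeg_iff.mpr ⟨m, homogeneousComponent_isHomogeneous _ _, Or.inl (by simp)⟩
  · exact absurd h0 (mul_ne_zero hL.2 hp)

theorem IsLine.app_mem_polyDeg {ℓ : Poly} (hL : IsLine ℓ) {δ : Fin 3 → Poly} {k : ℤ}
    (h : ∀ i, δ i ∈ polyDeg k) : app δ ℓ ∈ polyDeg k := by
  obtain ⟨a, -, rfl⟩ := hL.exists_coeff
  rw [app_sum_C_mul_X]
  exact Submodule.sum_mem _ fun i _ => polyDeg_mul (h i) (polyDeg_C _) (add_zero k)

/-- The partials of f share one degree, so homogeneous components of syzygies are syzygies. By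
noetherianity finitely many homogeneous elements generate; an inclusion-minimal such set is
irredundant, and is then sorted by degree. -/
theorem exists_isExponents {f : Poly} {n : ℕ} (hf : f.IsHomogeneous n) :
    ∃ (s : ℕ) (d : Fin s → ℕ), IsExponents f d := by
  classical
  set H : Set (Fin 3 → Poly) := {δ | ∃ k : ℕ, δ ∈ D0deg f k} with hH
  have hspan : Submodule.span Poly H = D0 f := by
    refine le_antisymm (Submodule.span_le.mpr ?_) fun δ hδ => ?_
    · rintro δ ⟨k, hk⟩
      exact (mem_D0deg_iff.mp hk).1
    · let c : ℕ → Fin 3 → Poly := fun k i => homogeneousComponent k (δ i)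
      have hc : ∀ k, c k ∈ H := fun k => by
        refine ⟨k, mem_D0deg_iff.mpr ⟨?_, fun i =>
          polyDeg_natCast.mpr (homogeneousComponent_isHomogeneous _ _)⟩⟩
        have h1 : app (c k) f = homogeneousComponent (n - 1 + k) (app δ f) := by
          simp only [app, map_sum]
          refine Finset.sum_congr rfl fun i _ => ?_
          rw [mul_comm (δ i), homogeneousComponent_mul_of_left hf.pderiv, mul_comm]
        rw [h1, mem_D0_iff.mp hδ, map_zero]
      let N := ∑ i, ((δ i).totalDegree + 1)
      have hsum : δ = ∑ k ∈ Finset.range N, c k := by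
        funext i
        rw [Finset.sum_apply]
        conv_lhs => rw [← sum_homogeneousComponent (δ i)]
        refine Finset.sum_subset (fun k hk => ?_) fun k _ hk => ?_
        · have : (δ i).totalDegree + 1 ≤ N :=
            Finset.single_le_sum (f := fun i => (δ i).totalDegree + 1)
              (fun _ _ => Nat.zero_le _) (Finset.mem_univ i)
          exact Finset.mem_range.mpr ((Finset.mem_range.mp hk).trans_le this)
        · exact homogeneousComponent_eq_zero _ _ (by simpa using hk)
      rw [hsum]
      exact Submodule.sum_mem _ fun k _ => Submodule.subset_span (hc k)
  obtain ⟨t₀, ht₀, ht₀'⟩ := (Submodule.fg_span_iff_fg_span_finset_subset H).mp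
    (IsNoetherian.noetherian (Submodule.span Poly H))
  obtain ⟨t, ⟨htH, htS⟩, hmin⟩ := wellFounded_lt.has_min
    {t : Finset (Fin 3 → Poly) | (t : Set (Fin 3 → Poly)) ⊆ H ∧
      Submodule.span Poly (t : Set (Fin 3 → Poly)) = D0 f} ⟨t₀, ht₀, by rw [← hspan, ht₀']⟩
  have hirr : ∀ x ∈ t, x ∉ Submodule.span Poly ((t : Set (Fin 3 → Poly)) \ {x}) := fun x hx hxs => by
    refine hmin (t.erase x) ⟨fun y hy => htH (Finset.mem_of_mem_erase hy), ?_⟩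
      (Finset.erase_ssubset hx)
    rw [Finset.coe_erase, ← htS]
    refine le_antisymm (Submodule.span_mono Set.sdiff_subset) (Submodule.span_le.mpr fun y hy => ?_)
    by_cases hyx : y = x
    · exact hyx ▸ hxs
    · exact Submodule.subset_span ⟨hy, hyx⟩
  let e : Fin t.card ≃ t := t.equivFin.symm
  choose g hg using fun i : Fin t.card => htH (e i).2
  let σ := Tuple.sort g
  have hinj : Function.Injective fun i => ((e (σ i) : t) : Fin 3 → Poly) :=
    Subtype.val_injective.comp (e.injective.comp σ.injective)
  have hrange : Set.range (fun i => ((e (σ i) : t) : Fin 3 → Poly)) = t := by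
    ext x
    refine ⟨fun ⟨i, hi⟩ => hi ▸ (e (σ i)).2, fun hx => ⟨σ.symm (e.symm ⟨x, hx⟩), by simp⟩⟩
  refine ⟨t.card, g ∘ σ, Tuple.monotone_sort g, fun i => (e (σ i) : t), fun i => hg _, ?_,
    fun i hi => ?_⟩
  · rw [hrange, htS]
  · refine hirr _ (e (σ i)).2 ?_
    rwa [Set.image_compl_eq_range_sdiff_image hinj, hrange, Set.image_singleton] at hi

/-! ### Tangent syzygies restricted to the line. -/

/-- Restriction of a polynomial to the parametrized affine line `t ↦ v + t w`. -/
noncomputable def restrictLine (v w : Fin 3 → ℂ) : Poly →ₐ[ℂ] Polynomial ℂ :=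
  aeval fun i => Polynomial.C (v i) + Polynomial.C (w i) * Polynomial.X

theorem restrictLine_X (v w : Fin 3 → ℂ) (i : Fin 3) :
    restrictLine v w (X i) = Polynomial.C (v i) + Polynomial.C (w i) * Polynomial.X := by
  simp [restrictLine]

theorem eval_restrictLine (v w : Fin 3 → ℂ) (t : ℂ) (p : Poly) :
    (restrictLine v w p).eval t = eval (v + t • w) p := by
  induction p using MvPolynomial.induction_on with
  | C a => simp
  | add p q hp hq => simp [hp, hq]
  | mul_X p i hp => simp [hp, restrictLine_X, mul_comm (w i) t]

theorem derivative_restrictLine (v w : Fin 3 → ℂ) (p : Poly) :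
    Polynomial.derivative (restrictLine v w p) =
      ∑ i, Polynomial.C (w i) * restrictLine v w (pderiv i p) := by
  induction p using MvPolynomial.induction_on with
  | C a => simp
  | add p q hp hq => simp [hp, hq, mul_add, Finset.sum_add_distrib]
  | mul_X p i hp =>
    rw [map_mul, Polynomial.derivative_mul, hp, restrictLine_X]
    fin_cases i <;>
      simp [Fin.sum_univ_three, pderiv_X, Pi.single_apply, restrictLine_X] <;> ring

theorem natDegree_restrictLine_le (v w : Fin 3 → ℂ) {p : Poly} {k : ℕ} (hp : p.IsHomogeneous k) :
    (restrictLine v w p).natDegree ≤ k := by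
  rw [restrictLine, aeval_def, eval₂_eq]
  refine Polynomial.natDegree_sum_le_of_forall_le _ _ fun m hm => ?_
  refine (Polynomial.natDegree_C_mul_le _ _).trans ?_
  refine (Polynomial.natDegree_prod_le _ _).trans ?_
  have hd : ∑ i, m i = k := by
    have := hp (mem_support_iff.mp hm)
    simpa [Finsupp.weight_apply, Finsupp.sum_fintype] using this
  rw [← hd, Finset.sum_subset (Finset.subset_univ m.support)]
  · refine Finset.sum_le_sum fun i _ => ?_
    refine Polynomial.natDegree_pow_le.trans ?_
    have : (Polynomial.C (v i) + Polynomial.C (w i) * Polynomial.X).natDegree ≤ 1 := by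
      compute_degree
    simpa using Nat.mul_le_mul_left (m i) this
  · intro i _ hi
    simp only [Finsupp.mem_support_iff, not_not] at hi
    simp [hi]

theorem eval_smul_of_isHomogeneous {p : Poly} {k : ℕ} (hp : p.IsHomogeneous k) (c : ℂ)
    (v : Fin 3 → ℂ) : eval (c • v) p = c ^ k * eval v p := by
  rw [eval_eq, eval_eq, Finset.mul_sum]
  refine Finset.sum_congr rfl fun m hm => ?_
  have hd : ∑ i, m i = k := by
    have := hp (mem_support_iff.mp hm)
    simpa [Finsupp.weight_apply, Finsupp.sum_fintype] using this
  simp only [Pi.smul_apply, smul_eq_mul]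
  rw [Finset.prod_congr rfl fun i _ => mul_pow _ _ _, Finset.prod_mul_distrib,
    Finset.prod_pow_eq_pow_sum, Finset.sum_subset (Finset.subset_univ _)
      (fun i _ hi => by simpa using hi), hd]
  ring

/-- A root of `φ` is a root of every `Q` such that `φ` divides `Q φ'`. -/
theorem eval_eq_zero_of_dvd_mul_derivative {φ Q : Polynomial ℂ} (hφ : φ ≠ 0) {t : ℂ}
    (ht : φ.IsRoot t) (h : φ ∣ Q * Polynomial.derivative φ) : Q.IsRoot t := by
  by_contra hQ
  have hd : Polynomial.derivative φ ≠ 0 := fun h0 => by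
    have h1 := Polynomial.derivative_eq_zero.mp h0
    rw [Polynomial.eq_C_of_natDegree_eq_zero h1] at ht hφ
    simp only [Polynomial.IsRoot, Polynomial.eval_C] at ht
    exact hφ (by rw [ht, map_zero])
  -- If Q(t) ≠ 0, the full power of X - t in φ would divide φ', whose multiplicity at t is one less.
  have hco : IsCoprime ((Polynomial.X - Polynomial.C t) ^ φ.rootMultiplicity t) Q := by
    refine IsCoprime.pow_left ?_
    rw [(Polynomial.irreducible_X_sub_C t).coprime_iff_not_dvd, Polynomial.dvd_iff_isRoot]
    exact hQ
  have h2 := hco.dvd_of_dvd_mul_left ((Polynomial.pow_rootMultiplicity_dvd φ t).trans h)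
  rw [← Polynomial.le_rootMultiplicity_iff hd,
    Polynomial.derivative_rootMultiplicity_of_root ht] at h2
  have h3 := (Polynomial.rootMultiplicity_pos hφ).mpr ht
  omega

theorem finrank_ker_dot {a : Fin 3 → ℂ} (ha : a ≠ 0) :
    Module.finrank ℂ (LinearMap.ker (Fintype.linearCombination ℂ a)) = 2 := by
  have h1 := LinearMap.finrank_range_add_finrank_ker (Fintype.linearCombination ℂ a)
  have h2 : LinearMap.range (Fintype.linearCombination ℂ a) = ⊤ := by
    refine LinearMap.range_eq_top.mpr (LinearMap.surjective fun h0 => ha (funext fun i => ?_))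
    have := DFunLike.congr_fun h0 (Pi.single i 1)
    simpa [Fintype.linearCombination_apply_single] using this
  rw [h2, finrank_top, Module.finrank_self, Module.finrank_fin_fun] at h1
  omega

theorem mem_ker_dot {a v : Fin 3 → ℂ} :
    v ∈ LinearMap.ker (Fintype.linearCombination ℂ a) ↔
      eval v (∑ i, C (a i) * X i : Poly) = 0 := by
  rw [LinearMap.mem_ker, Fintype.linearCombination_apply]
  simp [mul_comm]

theorem IsLine.exists_linearIndependent {ℓ : Poly} (hL : IsLine ℓ) {w : Fin 3 → ℂ}
    (hw0 : w ≠ 0) : ∃ v, eval v ℓ = 0 ∧ LinearIndependent ℂ ![w, v] := by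
  obtain ⟨a, ha, rfl⟩ := hL.exists_coeff
  by_contra! h
  have hle : LinearMap.ker (Fintype.linearCombination ℂ a) ≤ Submodule.span ℂ {w} := fun v hv => by
    have h1 := h v (mem_ker_dot.mp hv)
    rw [LinearIndependent.pair_iff' hw0] at h1
    push Not at h1
    exact Submodule.mem_span_singleton.mpr h1
  have h2 := Submodule.finrank_mono hle
  rw [finrank_ker_dot ha, finrank_span_singleton hw0] at h2
  omega

/-- The coordinates are extended to linear forms on all of ℂ³, so that they can also be applied to
triples of polynomials. -/
theorem IsLine.exists_coordinates {ℓ : Poly} (hL : IsLine ℓ) {v w : Fin 3 → ℂ}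
    (hv : eval v ℓ = 0) (hw : eval w ℓ = 0) (hvw : LinearIndependent ℂ ![w, v]) :
    ∃ ξ η : Fin 3 → ℂ, ∀ q, eval q ℓ = 0 →
      q = (∑ i, ξ i * q i) • v + (∑ i, η i * q i) • w := by
  obtain ⟨a, ha, rfl⟩ := hL.exists_coeff
  set K := LinearMap.ker (Fintype.linearCombination ℂ a)
  obtain ⟨g, hg⟩ := LinearMap.exists_leftInverse_of_injective (Fintype.linearCombination ℂ ![w, v])
    (LinearMap.ker_eq_bot.mpr hvw.fintypeLinearCombination_injective)
  have hspan : Submodule.span ℂ (Set.range ![w, v]) = K := by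
    refine Submodule.eq_of_le_of_finrank_eq (Submodule.span_le.mpr ?_) ?_
    · rintro _ ⟨i, rfl⟩
      fin_cases i
      · exact mem_ker_dot.mpr hw
      · exact mem_ker_dot.mpr hv
    · rw [finrank_ker_dot ha, finrank_span_eq_card hvw, Fintype.card_fin]
  have hlin : ∀ (j : Fin 2) (q : Fin 3 → ℂ), g q j = ∑ i, g (Pi.single i 1) j * q i := fun j q => by
    conv_lhs => rw [← Finset.univ_sum_single q, map_sum, Finset.sum_apply]
    refine Finset.sum_congr rfl fun i _ => ?_
    have : (Pi.single i (q i) : Fin 3 → ℂ) = q i • Pi.single i 1 := by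
      rw [← Pi.single_smul, smul_eq_mul, mul_one]
    rw [this, map_smul, Pi.smul_apply, smul_eq_mul, mul_comm]
  refine ⟨fun i => g (Pi.single i 1) 1, fun i => g (Pi.single i 1) 0, fun q hq => ?_⟩
  rw [← hlin, ← hlin]
  have hq' : q ∈ LinearMap.range (Fintype.linearCombination ℂ ![w, v]) := by
    rw [Fintype.range_linearCombination, hspan]
    exact mem_ker_dot.mpr hq
  obtain ⟨x, rfl⟩ := hq'
  have hx : g (Fintype.linearCombination ℂ ![w, v] x) = x := DFunLike.congr_fun hg x
  rw [hx, Fintype.linearCombination_apply]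
  simp [Fin.sum_univ_two, add_comm]

/-- The points of `f = 0` on the line `ℓ = 0` correspond to roots of the restriction of `f` to an
affine chart of the line whose point at infinity is not on `f = 0`. -/
theorem ncard_le_card_roots {f ℓ : Poly} {n : ℕ} (hf : f.IsHomogeneous n) (hL : IsLine ℓ)
    {v w : Fin 3 → ℂ} (hv : eval v ℓ = 0) (hw : eval w ℓ = 0) (hvw : LinearIndependent ℂ ![w, v])
    (hfw : eval w f ≠ 0) (hφ : restrictLine v w f ≠ 0) :
    (zeroSet f ∩ zeroSet ℓ).ncard ≤ (restrictLine v w f).roots.toFinset.card := by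
  have hne : ∀ t : ℂ, v + t • w ≠ 0 := fun t h0 => by
    have := (LinearIndependent.pair_iff.mp hvw) t 1 (by rw [one_smul, add_comm, h0])
    exact one_ne_zero this.2
  obtain ⟨ξ, η, hξη⟩ := hL.exists_coordinates hv hw hvw
  -- The inclusion also shows finiteness, so `ncard` is the actual number of points.
  have hsub : zeroSet f ∩ zeroSet ℓ ⊆
      (fun t => Projectivization.mk ℂ (v + t • w) (hne t)) ''
        ((restrictLine v w f).roots.toFinset : Set ℂ) := by
    rintro p ⟨hpf, hpℓ⟩
    have hp := hξη p.rep hpℓ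
    set s := ∑ i, ξ i * p.rep i
    set t := ∑ i, η i * p.rep i
    have hpf' : eval p.rep f = 0 := hpf
    -- For s = 0 the point would be [w], which is off the curve.
    have hs : s ≠ 0 := fun h0 => by
      rw [h0, zero_smul, zero_add] at hp
      have ht : t ≠ 0 := fun ht => p.rep_nonzero (by rw [hp, ht, zero_smul])
      rw [hp, eval_smul_of_isHomogeneous hf] at hpf'
      exact mul_ne_zero (pow_ne_zero _ ht) hfw hpf'
    have hrep : p.rep = s • (v + (t / s) • w) := by
      rw [smul_add, smul_smul, mul_div_cancel₀ _ hs, ← hp]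
    refine ⟨t / s, ?_, ?_⟩
    · simp only [Finset.mem_coe, Multiset.mem_toFinset, Polynomial.mem_roots hφ,
        Polynomial.IsRoot, eval_restrictLine]
      rw [hrep, eval_smul_of_isHomogeneous hf] at hpf'
      exact (mul_eq_zero.mp hpf').resolve_left (pow_ne_zero _ hs)
    · conv_rhs => rw [← p.mk_rep]
      rw [Projectivization.mk_eq_mk_iff']
      exact ⟨s⁻¹, by rw [hrep, smul_smul, inv_mul_cancel₀ hs, one_smul]⟩
  refine (Set.ncard_le_ncard hsub ((Finset.finite_toSet _).image _)).trans ?_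
  exact (Set.ncard_image_le (Finset.finite_toSet _)).trans (Set.ncard_coe_finset _).le

theorem eval_eq_zero_of_tangent {f ℓ : Poly} {n : ℕ} (hn : 0 < n) (hf : f.IsHomogeneous n)
    (hL : IsLine ℓ) {v w : Fin 3 → ℂ} (hv : eval v ℓ = 0) (hw : eval w ℓ = 0)
    (hvw : LinearIndependent ℂ ![w, v]) (hfw : eval w f ≠ 0) {δ : Fin 3 → Poly} {k : ℕ}
    (hδ : ∀ i, (δ i).IsHomogeneous k) (hδf : app δ f = 0) (hδℓ : ℓ ∣ app δ ℓ)
    (hk : k + 1 < (zeroSet f ∩ zeroSet ℓ).ncard) (i : Fin 3) : eval v (δ i) = 0 := by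
  have hn' : (n : ℂ) ≠ 0 := Nat.cast_ne_zero.mpr hn.ne'
  obtain ⟨ξ, η, hξη⟩ := hL.exists_coordinates hv hw hvw
  obtain ⟨a, -, ha⟩ := hL.exists_coeff
  set R := restrictLine v w with hR
  have hline : ∀ t : ℂ, eval (v + t • w) ℓ = 0 := fun t => by
    rw [ha, ← mem_ker_dot] at hv hw ⊢
    exact Submodule.add_mem _ hv (Submodule.smul_mem _ _ hw)
  set A : Polynomial ℂ := ∑ i, Polynomial.C (ξ i) * R (δ i) with hA
  set B : Polynomial ℂ := ∑ i, Polynomial.C (η i) * R (δ i) with hB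
  have hAB : ∀ i, R (δ i) = A * Polynomial.C (v i) + B * Polynomial.C (w i) := fun i => by
    refine Polynomial.funext fun t => ?_
    -- Tangency: at points of L the value of δ lies again in the plane spanned by v and w.
    have ht : eval (fun j => eval (v + t • w) (δ j)) ℓ = 0 := by
      have h1 := eval_eq_zero_of_dvd hδℓ (hline t)
      rw [ha, app_sum_C_mul_X] at h1
      rw [ha]
      simpa [mul_comm] using h1
    have := congrFun (hξη _ ht) i
    simpa [hA, hB, hR, Polynomial.eval_finsetSum, eval_restrictLine] using this
  set φ := R f with hφ
  set D : Polynomial ℂ := ∑ i, Polynomial.C (v i) * R (pderiv i f) with hD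
  have hder : Polynomial.derivative φ = ∑ i, Polynomial.C (w i) * R (pderiv i f) :=
    derivative_restrictLine v w f
  have heul : D + Polynomial.X * Polynomial.derivative φ = Polynomial.C (n : ℂ) * φ := by
    have h1 := congrArg R hf.sum_X_mul_pderiv
    rw [map_nsmul, nsmul_eq_mul, map_sum] at h1
    rw [hder, hD, map_natCast, ← h1, Finset.mul_sum, ← Finset.sum_add_distrib]
    refine Finset.sum_congr rfl fun j _ => ?_
    rw [map_mul, hR, restrictLine_X]
    ring
  have hkill : A * D + B * Polynomial.derivative φ = 0 := by
    have h1 := congrArg R hδf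
    rw [map_zero, app, map_sum] at h1
    rw [hder, hD, ← h1, Finset.mul_sum, Finset.mul_sum, ← Finset.sum_add_distrib]
    refine Finset.sum_congr rfl fun j _ => ?_
    rw [map_mul, hAB j]
    ring
  set Q := B - Polynomial.X * A with hQ
  -- Eliminates D, the restricted derivative of f along v, between the two relations.
  have hrel : Q * Polynomial.derivative φ = φ * (-Polynomial.C (n : ℂ) * A) := by
    linear_combination hkill - A * heul
  -- If φ = 0, then f vanishes at w + tv for all t ≠ 0, hence also at t = 0, contradicting f(w) ≠ 0.
  have hφ0 : φ ≠ 0 := fun h0 => by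
    have hpt : ∀ t : ℂ, eval (w + t • v) f = 0 ∨ t = 0 := fun t => by
      by_cases ht : t = 0
      · exact Or.inr ht
      · left
        have h1 : w + t • v = t • (v + t⁻¹ • w) := by
          rw [smul_add, smul_smul, mul_inv_cancel₀ ht, one_smul, add_comm]
        rw [h1, eval_smul_of_isHomogeneous hf, ← eval_restrictLine, ← hR, ← hφ, h0]
        simp
    have h2 : restrictLine w v f * Polynomial.X = 0 := Polynomial.funext fun t => by
      rw [Polynomial.eval_mul, eval_restrictLine, Polynomial.eval_X, Polynomial.eval_zero,
        mul_eq_zero]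
      exact hpt t
    have h3 := (mul_eq_zero.mp h2).resolve_right Polynomial.X_ne_zero
    have h4 := eval_restrictLine w v 0 f
    rw [h3, zero_smul, add_zero, Polynomial.eval_zero] at h4
    exact hfw h4.symm
  have hcard : _ ≤ φ.roots.toFinset.card := ncard_le_card_roots hf hL hv hw hvw hfw hφ0
  have hdeg : ∀ c : Fin 3 → ℂ, (∑ i, Polynomial.C (c i) * R (δ i)).natDegree ≤ k := fun c =>
    Polynomial.natDegree_sum_le_of_forall_le _ _ fun i _ =>
      (Polynomial.natDegree_C_mul_le _ _).trans (natDegree_restrictLine_le v w (hδ i))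
  have hQ0 : Q = 0 := by
    by_contra hQ0
    have hsub : φ.roots.toFinset ⊆ Q.roots.toFinset := fun t ht => by
      rw [Multiset.mem_toFinset, Polynomial.mem_roots hφ0] at ht
      rw [Multiset.mem_toFinset, Polynomial.mem_roots hQ0]
      exact eval_eq_zero_of_dvd_mul_derivative hφ0 ht ⟨_, hrel⟩
    have h1 := (Finset.card_le_card hsub).trans (Multiset.toFinset_card_le _)
    have h2 := Q.card_roots'
    have h3 : Q.natDegree ≤ k + 1 := by
      refine (Polynomial.natDegree_sub_le _ _).trans (max_le ((hdeg η).trans (Nat.le_succ k)) ?_)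
      refine Polynomial.natDegree_mul_le.trans ?_
      rw [Polynomial.natDegree_X, add_comm]
      exact Nat.succ_le_succ (hdeg ξ)
    omega
  have hA0 : A = 0 := by
    rw [hQ0, zero_mul] at hrel
    refine ((mul_eq_zero.mp ((mul_eq_zero.mp hrel.symm).resolve_left hφ0))).resolve_left ?_
    simpa using hn.ne'
  have hB0 : B = 0 := by
    rw [hQ, hA0, mul_zero, sub_zero] at hQ0
    exact hQ0
  have h5 := eval_restrictLine v w 0 (δ i)
  rw [← hR, hAB i, hA0, hB0, zero_smul, add_zero] at h5
  simpa using h5.symm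

/-- The chart argument covers points of L other than [w]. Multiples cw are reached along cw + tv: a
polynomial in t vanishing for all t ≠ 0 vanishes at 0. -/
theorem dvd_of_tangent {f ℓ : Poly} {n : ℕ} (hn : 0 < n) (hf : f.IsHomogeneous n)
    (hL : IsLine ℓ) {w : Fin 3 → ℂ} (hw : eval w ℓ = 0) (hfw : eval w f ≠ 0)
    (hw0 : w ≠ 0) {δ : Fin 3 → Poly} {k : ℕ}
    (hδ : ∀ i, (δ i).IsHomogeneous k) (hδf : app δ f = 0) (hδℓ : ℓ ∣ app δ ℓ)
    (hk : k + 1 < (zeroSet f ∩ zeroSet ℓ).ncard) (i : Fin 3) : ℓ ∣ δ i := by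
  refine hL.dvd_of_eval fun q hq => ?_
  by_cases hqw : LinearIndependent ℂ ![w, q]
  · exact eval_eq_zero_of_tangent hn hf hL hq hw hqw hfw hδ hδf hδℓ hk i
  rw [LinearIndependent.pair_iff' hw0] at hqw
  push Not at hqw
  obtain ⟨c, rfl⟩ := hqw
  obtain ⟨v, hv, hvw⟩ := hL.exists_linearIndependent hw0
  have h2 : restrictLine (c • w) v (δ i) * Polynomial.X = 0 := Polynomial.funext fun t => by
    rw [Polynomial.eval_mul, eval_restrictLine, Polynomial.eval_X, Polynomial.eval_zero,
      mul_eq_zero, or_iff_not_imp_right]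
    intro ht
    refine eval_eq_zero_of_tangent hn hf hL ?_ hw ?_ hfw hδ hδf hδℓ hk i
    · obtain ⟨a, -, rfl⟩ := hL.exists_coeff
      rw [← mem_ker_dot] at hq hv ⊢
      exact Submodule.add_mem _ hq (Submodule.smul_mem _ _ hv)
    · rw [LinearIndependent.pair_iff] at hvw ⊢
      intro x y hxy
      have h3 := hvw (x + y * c) (y * t) (by rw [← hxy]; module)
      have hy : y = 0 := (mul_eq_zero.mp h3.2).resolve_right ht
      refine ⟨by simpa [hy] using h3.1, hy⟩
  have h3 := (mul_eq_zero.mp h2).resolve_right Polynomial.X_ne_zero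
  have h4 := eval_restrictLine (c • w) v 0 (δ i)
  rw [h3, zero_smul, add_zero, Polynomial.eval_zero] at h4
  exact h4.symm

/-! ### The map `u0`: well-definedness, injectivity, surjectivity in low degrees. -/

theorem app_u0 (ℓ : Poly) (d : ℕ) (δ : Fin 3 → Poly) {g : Poly} {m : ℕ}
    (hg : g.IsHomogeneous m) :
    app (u0 ℓ d δ) g = ℓ * app δ g - C ((d : ℂ)⁻¹) * app δ ℓ * (C (m : ℂ) * g) := by
  rw [u0_apply, app_sub, app_smul, app_smul, app_euler hg]

/-- For δ killing f one has δ(ℓf) = f δ(ℓ), while E(ℓf) = (n + 1)ℓf; the factor 1/(n + 1) makes the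
two terms cancel. -/
theorem u0_mem_D0 {f ℓ : Poly} {n : ℕ} (hf : f.IsHomogeneous n) (hL : IsLine ℓ)
    {δ : Fin 3 → Poly} (hδ : δ ∈ D0 f) : u0 ℓ (n + 1) δ ∈ D0 (ℓ * f) := by
  have hd : C (((n + 1 : ℕ) : ℂ)⁻¹) * C ((n + 1 : ℕ) : ℂ) = (1 : Poly) := by
    rw [← C_mul, inv_mul_cancel₀ (Nat.cast_ne_zero.mpr n.succ_ne_zero), C_1]
  rw [mem_D0_iff, app_u0 ℓ (n + 1) δ (hL.1.mul hf), app_mul, mem_D0_iff.mp hδ, add_comm 1 n]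
  linear_combination -(app δ ℓ * ℓ * f) * hd

theorem u0_mem_D0deg {f ℓ : Poly} {n : ℕ} (hf : f.IsHomogeneous n) (hL : IsLine ℓ) {k : ℤ}
    {δ : Fin 3 → Poly} (hδ : δ ∈ D0deg f (k - 1)) : u0 ℓ (n + 1) δ ∈ D0deg (ℓ * f) k := by
  rw [mem_D0deg_iff] at hδ ⊢
  refine ⟨u0_mem_D0 hf hL hδ.1, fun i => Submodule.sub_mem _ ?_ ?_⟩
  · exact polyDeg_mul hL.mem_polyDeg (hδ.2 i) (by ring)
  · exact polyDeg_mul (polyDeg_mul (polyDeg_C _) (hL.app_mem_polyDeg hδ.2) (zero_add _))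
      (polyDeg_X i) (by ring)

/-- Since δ kills f, u₀(δ)(f) = -(n/(n + 1)) δ(ℓ) f. -/
theorem app_line_eq_zero_of_app_u0 {f ℓ : Poly} {n : ℕ} (hn : 0 < n) (hf : f.IsHomogeneous n)
    (hf0 : f ≠ 0) {δ : Fin 3 → Poly} (hδ : δ ∈ D0 f) (h : app (u0 ℓ (n + 1) δ) f = 0) :
    app δ ℓ = 0 := by
  rw [app_u0 ℓ (n + 1) δ hf, mem_D0_iff.mp hδ, mul_zero, zero_sub, neg_eq_zero] at h
  have h1 : C (((n + 1 : ℕ) : ℂ)⁻¹) ≠ (0 : Poly) :=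
    C_ne_zero.mpr (inv_ne_zero (Nat.cast_ne_zero.mpr n.succ_ne_zero))
  have h2 : C (n : ℂ) ≠ (0 : Poly) := C_ne_zero.mpr (Nat.cast_ne_zero.mpr hn.ne')
  exact ((mul_eq_zero.mp ((mul_eq_zero.mp h).resolve_right (mul_ne_zero h2 hf0)))).resolve_left h1

theorem u0_injOn {f ℓ : Poly} {n : ℕ} (hn : 0 < n) (hf : f.IsHomogeneous n)
    (hf0 : f ≠ 0) (hL : IsLine ℓ) {δ : Fin 3 → Poly} (hδ : δ ∈ D0 f)
    (h : u0 ℓ (n + 1) δ = 0) : δ = 0 := by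
  have h1 := app_line_eq_zero_of_app_u0 (ℓ := ℓ) hn hf hf0 hδ (by simp [h, app])
  rw [u0_apply, h1, mul_zero, zero_smul, sub_zero] at h
  exact (smul_eq_zero.mp h).resolve_left hL.2

/-- An element of the image of `u_0` killing `f` is divisible by `ℓ`. -/
theorem dvd_u0 {f ℓ : Poly} {n : ℕ} (hn : 0 < n) (hf : f.IsHomogeneous n)
    (hf0 : f ≠ 0) {δ : Fin 3 → Poly} (hδ : δ ∈ D0 f) (h : app (u0 ℓ (n + 1) δ) f = 0)
    (i : Fin 3) : ℓ ∣ u0 ℓ (n + 1) δ i := by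
  rw [u0_apply, app_line_eq_zero_of_app_u0 hn hf hf0 hδ h, mul_zero, zero_smul, sub_zero]
  exact ⟨δ i, rfl⟩

theorem exists_u0_eq {f ℓ : Poly} {n : ℕ} (hn : 0 < n) (hf : f.IsHomogeneous n)
    (hL : IsLine ℓ) {w : Fin 3 → ℂ} (hw : eval w ℓ = 0) (hfw : eval w f ≠ 0)
    (hw0 : w ≠ 0) {k : ℤ} (hk : k ≤ ((zeroSet f ∩ zeroSet ℓ).ncard : ℤ) - 2)
    {η : Fin 3 → Poly} (hη : η ∈ D0deg (ℓ * f) k) :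
    ∃ δ ∈ D0deg f (k - 1), u0 ℓ (n + 1) δ = η := by
  have hη' := hη
  rw [mem_D0deg_iff] at hη
  obtain ⟨hηf, hηk⟩ := hη
  have hn' : (n : ℂ) ≠ 0 := Nat.cast_ne_zero.mpr hn.ne'
  have hnC : C ((n : ℂ)⁻¹) * C (n : ℂ) = (1 : Poly) := by
    rw [← C_mul, inv_mul_cancel₀ hn', C_1]
  have hdC : C (((n + 1 : ℕ) : ℂ)⁻¹) * (C (n : ℂ) + 1) = (1 : Poly) := by
    rw [← C_1, ← C_add, ← C_mul, ← Nat.cast_succ,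
      inv_mul_cancel₀ (Nat.cast_ne_zero.mpr n.succ_ne_zero)]
  have hℓf : ¬ ℓ ∣ f := fun h => hfw (eval_eq_zero_of_dvd h hw)
  rw [app_mul] at hηf
  have hdvd : ℓ ∣ app η ℓ := by
    refine (hL.dvd_or_dvd (p := f) ?_).resolve_left hℓf
    exact ⟨-app η f, by linear_combination hηf⟩
  obtain ⟨h, hh⟩ := hdvd
  have hηf' : app η f = -(h * f) := by
    refine mul_left_cancel₀ hL.2 ?_
    rw [hh] at hηf
    linear_combination hηf
  have hhk : h ∈ polyDeg (k - 1) := hL.mem_polyDeg_of_mul (hh ▸ hL.app_mem_polyDeg hηk)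
  -- As E(f) = nf, adding (h/n)E cancels η(f) = -hf.
  set θ : Fin 3 → Poly := η + (C ((n : ℂ)⁻¹) * h) • euler with hθ
  have hθk : ∀ i, θ i ∈ polyDeg k := fun i => Submodule.add_mem _ (hηk i)
    (polyDeg_mul (polyDeg_mul (polyDeg_C _) hhk (zero_add _)) (polyDeg_X i) (by ring))
  have hθf : app θ f = 0 := by
    rw [hθ, app_add, app_smul, app_euler hf, hηf']
    linear_combination (h * f) * hnC
  have hθℓ : app θ ℓ = ℓ * (h + C ((n : ℂ)⁻¹) * h) := by
    rw [hθ, app_add, app_smul, app_euler hL.1, hh, Nat.cast_one, C_1]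
    ring
  have hθdvd : ∀ i, ℓ ∣ θ i := by
    by_cases hk0 : 0 ≤ k
    · lift k to ℕ using hk0
      exact dvd_of_tangent hn hf hL hw hfw hw0 (fun i => polyDeg_natCast.mp (hθk i)) hθf
        ⟨_, hθℓ⟩ (by omega)
    · intro i
      obtain ⟨m, -, hm | h0⟩ := mem_polyDeg_iff.mp (hθk i)
      · omega
      · rw [h0]
        exact dvd_zero _
  choose δ hδ using hθdvd
  have hθδ : θ = ℓ • δ := funext hδ
  have hδℓ : app δ ℓ = h + C ((n : ℂ)⁻¹) * h := by
    refine mul_left_cancel₀ hL.2 ?_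
    rw [← hθℓ, hθδ, app_smul]
  refine ⟨δ, mem_D0deg_iff.mpr ⟨?_, fun i => hL.mem_polyDeg_of_mul (hδ i ▸ hθk i)⟩, ?_⟩
  · rw [hθδ, app_smul] at hθf
    exact (mul_eq_zero.mp hθf).resolve_left hL.2
  -- (1/(n + 1))(1 + 1/n) = 1/n, so `u0` subtracts exactly the Euler term added to η.
  · have hc : C (((n + 1 : ℕ) : ℂ)⁻¹) * (h + C ((n : ℂ)⁻¹) * h) = C ((n : ℂ)⁻¹) * h := by
      linear_combination (C ((n : ℂ)⁻¹) * h) * hdC - (h * C (((n + 1 : ℕ) : ℂ)⁻¹)) * hnC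
    rw [u0_apply, ← hθδ, hδℓ, hc, hθ, add_sub_cancel_right]

/-! ### The syzygy κ outside the image; dimensions and exponents. -/

/-- The derivation `g ↦ det (∇ℓ, ∇f, ∇g)`, which kills both `ℓ` and `f`. -/
theorem exists_mem_D0deg_not_dvd {f ℓ : Poly} {n : ℕ} (hn : 0 < n) (hf : f.IsHomogeneous n)
    (hL : IsLine ℓ) {w : Fin 3 → ℂ} (hw : eval w ℓ = 0) (hfw : eval w f ≠ 0) :
    ∃ κ : Fin 3 → Poly, κ ∈ D0deg (ℓ * f) ((n - 1 : ℕ) : ℤ) ∧ app κ f = 0 ∧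
      ¬ ∀ i, ℓ ∣ κ i := by
  obtain ⟨a, ha, hℓ⟩ := hL.exists_coeff
  set κ : Fin 3 → Poly := ![C (a 1) * pderiv 2 f - C (a 2) * pderiv 1 f,
    C (a 2) * pderiv 0 f - C (a 0) * pderiv 2 f,
    C (a 0) * pderiv 1 f - C (a 1) * pderiv 0 f] with hκ
  have hκf : app κ f = 0 := by
    simp [app, hκ, Fin.sum_univ_three]
    ring
  have hκℓ : app κ ℓ = 0 := by
    rw [hℓ, app_sum_C_mul_X]
    simp [hκ, Fin.sum_univ_three]
    ring
  have hdeg : ∀ i j, C (a i) * pderiv j f ∈ polyDeg ((n - 1 : ℕ) : ℤ) := fun i j =>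
    polyDeg_natCast.mpr (hf.pderiv.C_mul _)
  refine ⟨κ, mem_D0deg_iff.mpr ⟨by rw [app_mul, hκf, hκℓ, mul_zero, mul_zero, add_zero],
    fun i => ?_⟩, hκf, fun hdvd => ?_⟩
  · fin_cases i <;> exact Submodule.sub_mem _ (hdeg _ _) (hdeg _ _)
  · have hz := fun i => eval_eq_zero_of_dvd (hdvd i) hw
    have h0 : a 1 * eval w (pderiv 2 f) - a 2 * eval w (pderiv 1 f) = 0 := by
      simpa [hκ] using hz 0
    have h1 : a 2 * eval w (pderiv 0 f) - a 0 * eval w (pderiv 2 f) = 0 := by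
      simpa [hκ] using hz 1
    have h2 : a 0 * eval w (pderiv 1 f) - a 1 * eval w (pderiv 0 f) = 0 := by
      simpa [hκ] using hz 2
    have hE : ∑ i, w i * eval w (pderiv i f) = n * eval w f := by
      have := congrArg (eval w) hf.sum_X_mul_pderiv
      simpa using this
    have hl : ∑ i, a i * w i = 0 := by
      rw [hℓ] at hw
      simpa using hw
    rw [Fin.sum_univ_three] at hE hl
    have hne : (n : ℂ) * eval w f ≠ 0 := mul_ne_zero (Nat.cast_ne_zero.mpr hn.ne') hfw
    refine ha (funext fun i => ?_)
    refine (mul_eq_zero.mp (?_ : a i * (n * eval w f) = 0)).resolve_right hne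
    -- With g = ∇f(w), the identity w × (a × g) = a(w·g) - g(w·a), together with a × g = 0 and a·w =
    -- 0, gives a · n f(w) = 0.
    fin_cases i <;> simp only [Fin.zero_eta, Fin.mk_one, Fin.reduceFinMk] <;> rw [← hE]
    · linear_combination (eval w (pderiv 0 f)) * hl + w 1 * h2 - w 2 * h1
    · linear_combination (eval w (pderiv 1 f)) * hl + w 2 * h0 - w 0 * h2
    · linear_combination (eval w (pderiv 2 f)) * hl + w 0 * h1 - w 1 * h0

/-- The map `D_0(f)_{k-1} → D_0(ℓ f)_k` induced by `u_0`. -/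
noncomputable def u0deg {f ℓ : Poly} {n : ℕ} (hf : f.IsHomogeneous n) (hL : IsLine ℓ) (k : ℤ) :
    D0deg f (k - 1) →ₗ[ℂ] D0deg (ℓ * f) k :=
  ((u0 ℓ (n + 1)).restrictScalars ℂ).restrict fun _ hδ => u0_mem_D0deg hf hL hδ

theorem u0deg_injective {f ℓ : Poly} {n : ℕ} (hn : 0 < n) (hf : f.IsHomogeneous n)
    (hf0 : f ≠ 0) (hL : IsLine ℓ) (k : ℤ) : Function.Injective (u0deg hf hL k) := by
  refine (injective_iff_map_eq_zero _).mpr fun δ hδ => Subtype.ext ?_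
  exact u0_injOn hn hf hf0 hL (mem_D0deg_iff.mp δ.2).1 (congrArg Subtype.val hδ)

theorem finrank_D0deg_lt {f ℓ : Poly} {n : ℕ} (hn : 0 < n) (hf : f.IsHomogeneous n)
    (hL : IsLine ℓ) {w : Fin 3 → ℂ} (hw : eval w ℓ = 0) (hfw : eval w f ≠ 0) (hw0 : w ≠ 0)
    {k : ℤ} (hk : (n : ℤ) ≤ k) :
    Module.finrank ℂ (D0deg f (k - 1)) < Module.finrank ℂ (D0deg (ℓ * f) k) := by
  have hf0 : f ≠ 0 := fun h => hfw (by rw [h, map_zero])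
  obtain ⟨κ, hκ, hκf, hκd⟩ := exists_mem_D0deg_not_dvd hn hf hL hw hfw
  obtain ⟨j, hj⟩ := Function.ne_iff.mp hw0
  -- κ has degree n - 1 and is raised to degree k by a power of a coordinate nonzero at w, hence not
  -- divisible by ℓ.
  obtain ⟨m, hm⟩ := Int.eq_ofNat_of_zero_le (show 0 ≤ k - ((n - 1 : ℕ) : ℤ) by omega)
  have hXm : (X j ^ m : Poly) ∈ polyDeg m := polyDeg_natCast.mpr (isHomogeneous_X_pow _ _)
  have hη : (X j ^ m : Poly) • κ ∈ D0deg (ℓ * f) k := by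
    rw [mem_D0deg_iff] at hκ ⊢
    refine ⟨by rw [app_smul, hκ.1, mul_zero], fun i => polyDeg_mul hXm (hκ.2 i) (by omega)⟩
  have := finite_D0deg (ℓ * f) k
  rw [← LinearMap.finrank_range_of_inj (u0deg_injective hn hf hf0 hL k)]
  refine Submodule.finrank_lt fun htop => hκd fun i => ?_
  obtain ⟨δ, hδ⟩ := (htop ▸ Submodule.mem_top :
    (⟨_, hη⟩ : D0deg (ℓ * f) k) ∈ LinearMap.range (u0deg hf hL k))
  have hδ' : u0 ℓ (n + 1) δ = (X j ^ m : Poly) • κ := congrArg Subtype.val hδ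
  have h1 := dvd_u0 (ℓ := ℓ) hn hf hf0 (mem_D0deg_iff.mp δ.2).1
    (by rw [hδ', app_smul, hκf, mul_zero]) i
  rw [hδ', Pi.smul_apply, smul_eq_mul] at h1
  refine (hL.dvd_or_dvd h1).resolve_left fun h2 => ?_
  have h3 := eval_eq_zero_of_dvd h2 hw
  rw [map_pow, eval_X] at h3
  exact hj (eq_zero_of_pow_eq_zero h3)

theorem IsExponents.le_last {f ℓ : Poly} {n : ℕ} (hn : 0 < n) (hf : f.IsHomogeneous n)
    (hL : IsLine ℓ) {w : Fin 3 → ℂ} (hw : eval w ℓ = 0) (hfw : eval w f ≠ 0) (hw0 : w ≠ 0)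
    {s : ℕ} {d : Fin s → ℕ} (hd : IsExponents (ℓ * f) d) :
    ∃ hs : 0 < s, ((zeroSet f ∩ zeroSet ℓ).ncard : ℤ) - 1 ≤
      (d ⟨s - 1, Nat.sub_lt hs Nat.one_pos⟩ : ℤ) := by
  have hf0 : f ≠ 0 := fun h => hfw (by rw [h, map_zero])
  obtain ⟨κ, hκ, hκf, hκd⟩ := exists_mem_D0deg_not_dvd hn hf hL hw hfw
  obtain ⟨hmono, ρ, hρ, hspan, -⟩ := hd
  have hκ0 : κ ∈ D0 (ℓ * f) := (mem_D0deg_iff.mp hκ).1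
  have hs : 0 < s := by
    rcases Nat.eq_zero_or_pos s with rfl | hs
    · rw [← hspan, Set.range_eq_empty, Submodule.span_empty, Submodule.mem_bot] at hκ0
      exact absurd (fun i => by simp [hκ0]) hκd
    · exact hs
  refine ⟨hs, ?_⟩
  by_contra! hlt
  -- All generators now have degree at most r - 2, so `exists_u0_eq` applies to each, and `u0` is
  -- S-linear.
  have hle : D0 (ℓ * f) ≤ (D0 f).map (u0 ℓ (n + 1)) := by
    rw [← hspan, Submodule.span_le]
    rintro _ ⟨i, rfl⟩
    have hi : d i ≤ d ⟨s - 1, Nat.sub_lt hs Nat.one_pos⟩ :=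
      hmono (Fin.le_def.mpr (Nat.le_sub_one_of_lt i.2))
    obtain ⟨δ, hδ, hδ'⟩ := exists_u0_eq hn hf hL hw hfw hw0 (by omega) (hρ i)
    exact ⟨δ, (mem_D0deg_iff.mp hδ).1, hδ'⟩
  obtain ⟨δ, hδ, rfl⟩ := hle hκ0
  exact hκd fun i => dvd_u0 hn hf hf0 hδ hκf i

end JacSyz

theorem corollary1p9 (n : ℕ) (f' ℓ : JacSyz.Poly)
    (hC' : JacSyz.IsReducedCurve f' n) (hL : JacSyz.IsLine ℓ)
    (hLC' : ¬ JacSyz.zeroSet ℓ ⊆ JacSyz.zeroSet f')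
    (r : ℕ) (hr : r = (JacSyz.zeroSet f' ∩ JacSyz.zeroSet ℓ).ncard) :
    -- `u_0` is a morphism from `D_0(f')(-1)` to `D_0(f)`, where `f = ℓ f'` has degree `n + 1`
    (∀ k : ℤ, ∀ δ ∈ JacSyz.D0deg f' (k - 1),
      JacSyz.u0 ℓ (n + 1) δ ∈ JacSyz.D0deg (ℓ * f') k) ∧
    -- it induces isomorphisms in degrees at most `r - 2`
    (∀ k : ℤ, k ≤ (r : ℤ) - 2 →
      ∃ φ : JacSyz.D0deg f' (k - 1) ≃ₗ[ℂ] JacSyz.D0deg (ℓ * f') k,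
        ∀ δ : JacSyz.D0deg f' (k - 1),
          (φ δ : Fin 3 → JacSyz.Poly) = JacSyz.u0 ℓ (n + 1) δ) ∧
    -- strict inequality of dimensions in large degrees
    (∃ k₀ : ℤ, ∀ k : ℤ, k₀ ≤ k →
      Module.finrank ℂ (JacSyz.D0deg f' (k - 1)) <
        Module.finrank ℂ (JacSyz.D0deg (ℓ * f') k)) ∧
    -- the exponents `d_1 ≤ ⋯ ≤ d_s` of `f = 0` exist, and `d_s ≥ r - 1`
    (∃ (s : ℕ) (d : Fin s → ℕ), JacSyz.IsExponents (ℓ * f') d) ∧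
    (∀ (s : ℕ) (d : Fin s → ℕ), JacSyz.IsExponents (ℓ * f') d →
      ∃ hs : 0 < s, (r : ℤ) - 1 ≤ (d ⟨s - 1, Nat.sub_lt hs Nat.one_pos⟩ : ℤ)) := by
  obtain ⟨hn, hf, -⟩ := hC'
  -- A representative of this point of L off the curve serves as w throughout.
  obtain ⟨p, hpℓ, hpf⟩ := Set.not_subset.mp hLC'
  have hw : MvPolynomial.eval p.rep ℓ = 0 := hpℓ
  have hfw : MvPolynomial.eval p.rep f' ≠ 0 := hpf
  have hw0 := p.rep_nonzero
  have hf0 : f' ≠ 0 := fun h => hfw (by rw [h, map_zero])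
  subst hr
  refine ⟨fun k δ hδ => JacSyz.u0_mem_D0deg hf hL hδ, fun k hk => ?_,
    ⟨n, fun k hk => JacSyz.finrank_D0deg_lt hn hf hL hw hfw hw0 hk⟩,
    JacSyz.exists_isExponents (hL.1.mul hf),
    fun s d hd => hd.le_last hn hf hL hw hfw hw0⟩
  refine ⟨LinearEquiv.ofBijective (JacSyz.u0deg hf hL k)
    ⟨JacSyz.u0deg_injective hn hf hf0 hL k, fun η => ?_⟩, fun δ => rfl⟩
  obtain ⟨δ, hδ, h⟩ := JacSyz.exists_u0_eq hn hf hL hw hfw hw0 hk η.2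
  exact ⟨⟨δ, hδ⟩, Subtype.ext h⟩
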